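/- Let $d \ge 1$. A polyhedral cone in $\mathbb{R}^d$ (with apex at the origin) is an intersection of finitely many linear half-spaces; let $\mathcal{C}_d$ be the set of all of them. A cone angle on $\mathbb{R}^d$ is a map $\alpha : \mathcal{C}_d \to \mathbb{R}$ such that $\alpha(\{0\}) = 0$, $\alpha(C \cup C') = \alpha(C) + \alpha(C') - \alpha(C \cap C')$ whenever $C, C', C \cup C', C \cap C' \in \mathcal{C}_d$, $\alpha(C) = 0$ whenever $\dim C < d$, and $\alpha(\mathbb{R}^d) = 1$. For a nonempty face $F$ of a polytope $P \subset \mathbb{R}^d$, let $L(F)$ be the linear subspace parallel to the affine hull of $F$, let $$N_F P = \{ c \in \mathbb{R}^d : \langle c, x\rangle \ge \langle c, y \rangle \text{ for all } x \in F,\ y \in P \}$$ be the normal cone and $O_F P = N_F P + L(F)$ the outer cone of $P$ at $F$. The exterior angle vector of $P$ is $\check\alpha(P) = (\check\alpha_0(P), \dots, \check\alpha_{d-1}(P))$ with $\check\alpha_i(P) = \sum_F \alpha(O_F P)$, the sum being over all faces $F$ of $P$ of dimension $i$. Then, for every cone angle $\alpha$ on $\mathbb{R}^d$, $$\operatorname{aff}\{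 \check\alpha(P) : P \subset \mathbb{R}^d \text{ a } d\text{-dimensional polytope} \} = \{ (a_0, \dots, a_{d-1}) \in \mathbb{R}^d : a_0 = 1 \}.$$ Consequently $\check\alpha_0 = 1$ is, up to scaling, the only linear relation: for real numbers $c_0, \dots, c_{d-1}, b$, one has $\sum_{i=0}^{d-1} c_i \check\alpha_i(P) = b$ for all $d$-dimensional polytopes $P \subset \mathbb{R}^d$ if and only if $c_0 = b$ and $c_1 = \dots = c_{d-1} = 0$. -/

import Mathlib

noncomputable section

/-- The Euclidean space `ℝ^d` with its standard inner product. -/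
abbrev Euc (d : ℕ) : Type := EuclideanSpace ℝ (Fin d)

/-- Polyhedral cones in `ℝ^d` with apex at the origin: the intersections of finitely many linear
half-spaces `{x | ⟪z, x⟫ ≥ 0}`. -/
abbrev PolyhedralCone (d : ℕ) : Type :=
  {C : PointedCone ℝ (Euc d) // PointedCone.DualFG (innerₗ (Euc d)) C}

namespace PolyhedralCone

variable {d : ℕ}

/-- The underlying set of points of a polyhedral cone. -/
def points (C : PolyhedralCone d) : Set (Euc d) := (C.1 : Set (Euc d))

/-- The dimension of a cone is the dimension of its linear hull. -/
def dim (C : PolyhedralCone d) : ℕ := Module.finrank ℝ (Submodule.span ℝ C.points)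

end PolyhedralCone

/-- A cone angle on `ℝ^d`: a simple real-valued valuation on the polyhedral cones, normalized to
take the value `1` on `ℝ^d`. -/
structure ConeAngle (d : ℕ) where
  toFun : PolyhedralCone d → ℝ
  map_zero' : ∀ C : PolyhedralCone d, C.points = {0} → toFun C = 0
  map_union' : ∀ C C' U I : PolyhedralCone d,
    U.points = C.points ∪ C'.points → I.points = C.points ∩ C'.points →
      toFun U = toFun C + toFun C' - toFun I
  map_of_dim_lt' : ∀ C : PolyhedralCone d, C.dim < d → toFun C = 0
  map_univ' : ∀ C : PolyhedralCone d, C.points = Set.univ → toFun C = 1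

instance (d : ℕ) : CoeFun (ConeAngle d) (fun _ => PolyhedralCone d → ℝ) := ⟨ConeAngle.toFun⟩

/-- The normal cone `N_F P = {c | ⟪c, x⟫ ≥ ⟪c, y⟫ for all x ∈ F, y ∈ P}`. -/
def normalCone {d : ℕ} (F P : Set (Euc d)) : PointedCone ℝ (Euc d) where
  carrier := {c | ∀ x ∈ F, ∀ y ∈ P, inner ℝ c y ≤ inner ℝ c x}
  zero_mem' := by
    intro x _ y _
    simp
  add_mem' := by
    intro a b ha hb x hx y hy
    simpa only [inner_add_left] using add_le_add (ha x hx y hy) (hb x hx y hy)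
  smul_mem' := by
    intro r c hc x hx y hy
    have h : (r • c : Euc d) = (r : ℝ) • c := rfl
    rw [h, real_inner_smul_left, real_inner_smul_left]
    exact mul_le_mul_of_nonneg_left (hc x hx y hy) r.2

/-- The linear subspace `L(F)` parallel to the affine hull of `F`. -/
abbrev parallelSubspace {d : ℕ} (F : Set (Euc d)) : Submodule ℝ (Euc d) := vectorSpan ℝ F

/-- The outer cone `O_F P = N_F P + L(F)`. -/
def outerCone {d : ℕ} (F P : Set (Euc d)) : PointedCone ℝ (Euc d) :=
  normalCone F P ⊔ PointedCone.ofSubmodule (parallelSubspace F)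

/-- The outer cone of a polytope at a nonempty subset is polyhedral. -/
theorem outerCone_dualFG {d : ℕ} {F P : Set (Euc d)} (V : Finset (Euc d))
    (hP : P = convexHull ℝ (V : Set (Euc d))) (hF : F.Nonempty) (hFP : F ⊆ P) :
    PointedCone.DualFG (innerₗ (Euc d)) (outerCone F P) := by
  classical
  subst hP
  obtain ⟨x₀, hx₀⟩ := hF
  set L : Submodule ℝ (Euc d) := parallelSubspace F with hL
  refine ⟨V.image (fun v => Lᗮ.starProjection (x₀ - v)), ?_⟩
  ext x
  simp only [PointedCone.mem_dual, Finset.coe_image, Set.mem_image, Finset.mem_coe,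
    forall_exists_index, and_imp, forall_apply_eq_imp_iff₂, innerₗ_apply_apply]
  have hsymm : ∀ v, inner ℝ (Lᗮ.starProjection (x₀ - v)) x
      = inner ℝ (Lᗮ.starProjection x) (x₀ - v) := by
    intro v
    rw [Submodule.inner_starProjection_left_eq_right, real_inner_comm]
  simp only [hsymm]
  constructor
  · intro h
    have hn : Lᗮ.starProjection x ∈ normalCone F (convexHull ℝ (V : Set (Euc d))) := by
      intro a ha y hy
      have h1 : inner ℝ (Lᗮ.starProjection x) (a - x₀) = 0 := by
        have h2 : a - x₀ ∈ L := vsub_mem_vectorSpan ℝ ha hx₀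
        rw [real_inner_comm]
        exact (Submodule.mem_orthogonal L _).1 (Submodule.starProjection_apply_mem _ _) _ h2
      have h3 : convexHull ℝ (V : Set (Euc d)) ⊆
          {y | inner ℝ (Lᗮ.starProjection x) y ≤ inner ℝ (Lᗮ.starProjection x) x₀} := by
        apply convexHull_min
        · intro v hv
          have := h v hv
          rw [inner_sub_right] at this
          simpa using this
        · exact convex_halfSpace_le
            (innerₗ (Euc d) (Lᗮ.starProjection x)).isLinear _
      have h4 := h3 hy
      rw [inner_sub_right] at h1
      simp only [Set.mem_ofPred_eq] at h4
      linarith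
    have hs : x = Lᗮ.starProjection x + L.starProjection x := by
      rw [add_comm, Submodule.starProjection_add_starProjection_orthogonal]
    rw [hs]
    exact Submodule.add_mem_sup hn (Submodule.starProjection_apply_mem L x)
  · intro h v hv
    obtain ⟨c, hc, l, hl, rfl⟩ := Submodule.mem_sup.1 h
    have hcL : c ∈ Lᗮ := by
      have hle : L ≤ (ℝ ∙ c)ᗮ := by
        rw [hL, parallelSubspace, vectorSpan_def, Submodule.span_le]
        rintro _ ⟨a, ha, b, hb, rfl⟩
        rw [SetLike.mem_coe, Submodule.mem_orthogonal_singleton_iff_inner_right]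
        have h1 := hc a ha b (hFP hb)
        have h2 := hc b hb a (hFP ha)
        simp only [vsub_eq_sub, inner_sub_right]
        linarith
      rw [Submodule.mem_orthogonal]
      intro u hu
      have := Submodule.mem_orthogonal_singleton_iff_inner_right.1 (hle hu)
      rw [real_inner_comm]
      exact this
    have hlL : l ∈ Lᗮᗮ := by
      rw [Submodule.orthogonal_orthogonal]
      exact hl
    have e1 : Lᗮ.starProjection c = c := Submodule.starProjection_eq_self_iff.2 hcL
    have e2 : Lᗮ.starProjection l = 0 :=
      (Submodule.starProjection_apply_eq_zero_iff _).2 hlL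
    rw [map_add, e1, e2, add_zero, inner_sub_right]
    have := hc x₀ hx₀ v (subset_convexHull ℝ _ hv)
    linarith

/-- A polytope in `ℝ^d`: the convex hull of a finite set of points. -/
structure Polytope (d : ℕ) where
  points : Set (Euc d)
  isPolytope' : ∃ V : Finset (Euc d), points = convexHull ℝ (V : Set (Euc d))

namespace Polytope

variable {d : ℕ}

/-- The dimension of a polytope is the dimension of its affine hull. -/
def dim (P : Polytope d) : ℕ := Module.finrank ℝ (parallelSubspace P.points)

/-- The nonempty faces of dimension `i` of a polytope `P`: the nonempty sets of maximizers over `P`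
of a linear function (the zero function gives `P` itself). -/
abbrev Face (P : Polytope d) (i : ℕ) : Type :=
  {F : Set (Euc d) // F.Nonempty ∧ IsExposed ℝ P.points F ∧
    Module.finrank ℝ (parallelSubspace F) = i}

/-- A polytope has finitely many faces. -/
instance (P : Polytope d) (i : ℕ) : Finite (P.Face i) := by
  obtain ⟨V, hV⟩ := P.isPolytope'
  have hc : IsCompact P.points := by
    rw [hV]
    exact V.finite_toSet.isCompact_convexHull ℝ
  have hconv : Convex ℝ P.points := by
    rw [hV]
    exact convex_convexHull ℝ _
  have hfin : (𝒫 (V : Set (Euc d))).Finite := V.finite_toSet.finite_subsets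
  have := hfin.to_subtype
  refine Finite.of_injective (β := 𝒫 (V : Set (Euc d)))
    (fun F => ⟨F.1.extremePoints ℝ, ?_⟩) ?_
  · have h : P.points.extremePoints ℝ ⊆ (V : Set (Euc d)) := by
      rw [hV]
      exact extremePoints_convexHull_subset
    rw [F.2.2.1.isExtreme.extremePoints_eq]
    exact Set.inter_subset_right.trans h
  · intro F G h
    have h' : F.1.extremePoints ℝ = G.1.extremePoints ℝ := congrArg Subtype.val h
    apply Subtype.ext
    rw [← closure_convexHull_extremePoints (F.2.2.1.isCompact hc) (F.2.2.1.convex hconv), h',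
      closure_convexHull_extremePoints (G.2.2.1.isCompact hc) (G.2.2.1.convex hconv)]

/-- The outer cone of `P` at a face, as a polyhedral cone. -/
def outerConeAt (P : Polytope d) {i : ℕ} (F : P.Face i) : PolyhedralCone d :=
  ⟨outerCone F.1 P.points, by
    obtain ⟨V, hV⟩ := P.isPolytope'
    exact outerCone_dualFG V hV F.2.1 F.2.2.1.subset⟩

end Polytope

/-- The exterior angle vector of `P`: its `i`-th entry, `0 ≤ i ≤ d - 1`, is the sum of the exterior
angles `α(O_F P)` over the (finitely many) faces `F` of `P` of dimension `i`. -/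
def ConeAngle.exteriorAngleVector {d : ℕ} (α : ConeAngle d) (P : Polytope d) : Fin d → ℝ :=
  fun i => ∑ᶠ F : P.Face i, α (P.outerConeAt F)

end

/-!
The outer cones at the faces of a polytope `P` that are parallel to a fixed subspace `L` never
overlap: for two such faces they are separated by a hyperplane (`ae_notMem_outerCone_of_ne`). They
cover `ℝ^d` as soon as generic directions orthogonal to `L` are maximized on `P` along a face
parallel to `L`. A cone angle adds up to `1` over any finite tiling of `ℝ^d` by polyhedral cones
(`ConeAngle.sum_eq_one_of_ae_existsUnique`). The valuation property applies only to unions that are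
again cones, and it is brought to bear by cutting along all facet hyperplanes of the tiles. So the
exterior angles at such faces add up to `1` (`ConeAngle.sum_face_parallel_eq_one`).

With `L = 0` this gives `α̌₀(P) = 1` for every polytope (`ConeAngle.exteriorAngleVector_zero`). For
a zonotope with `n ≥ d` generators in general position, the subspaces parallel to `k`-faces are the
spans of `k` generators when `k < d`, and each of them contributes `1`, whence `α̌ₖ = n.choose k`
for every cone angle (`InGeneralPosition.exteriorAngleVector_zonotope`). As functions of `n` these
binomial coefficients are linearly independent, so no other affine relation can hold on these
zonotopes; the description of the affine hull follows by duality.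
-/

open MeasureTheory
open scoped RealInnerProductSpace

/-! ### Cone angles of tilings -/

namespace PolyhedralCone

variable {d : ℕ}

/-- The polyhedral cone cut out by the half-spaces `{x | 0 ≤ ⟪z, x⟫}`, `z ∈ s`. -/
noncomputable def ofFinset (s : Finset (Euc d)) : PolyhedralCone d :=
  ⟨PointedCone.dual (innerₗ (Euc d)) (s : Set (Euc d)), s, rfl⟩

theorem mem_points_ofFinset {s : Finset (Euc d)} {x : Euc d} :
    x ∈ (ofFinset s).points ↔ ∀ z ∈ s, 0 ≤ ⟪z, x⟫ := by
  simp [ofFinset, points, PointedCone.mem_dual]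

theorem eq_of_points_eq {C D : PolyhedralCone d} (h : C.points = D.points) : C = D :=
  Subtype.ext (SetLike.coe_injective h)

theorem exists_eq_ofFinset (C : PolyhedralCone d) : ∃ s : Finset (Euc d), C = ofFinset s := by
  obtain ⟨C, s, rfl⟩ := C
  exact ⟨s, rfl⟩

theorem orthogonal_singleton_ne_top {z : Euc d} (hz : z ≠ 0) : (ℝ ∙ z)ᗮ ≠ ⊤ := by
  intro h
  have : z ∈ (ℝ ∙ z)ᗮ := h ▸ Submodule.mem_top
  exact hz (inner_self_eq_zero.1 (Submodule.mem_orthogonal_singleton_iff_inner_right.1 this))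

theorem dim_lt_of_subset_hyperplane {C : PolyhedralCone d} {z : Euc d} (hz : z ≠ 0)
    (h : ∀ x ∈ C.points, ⟪z, x⟫ = 0) : C.dim < d := by
  have h1 : Submodule.span ℝ C.points ≤ (ℝ ∙ z)ᗮ :=
    Submodule.span_le.2 fun x hx =>
      Submodule.mem_orthogonal_singleton_iff_inner_right.2 (h x hx)
  calc C.dim ≤ Module.finrank ℝ (ℝ ∙ z)ᗮ := Submodule.finrank_mono h1
    _ < Module.finrank ℝ (Euc d) := Submodule.finrank_lt (orthogonal_singleton_ne_top hz)
    _ = d := by simp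

theorem ae_inner_ne_zero {z : Euc d} (hz : z ≠ 0) : ∀ᵐ x : Euc d, ⟪z, x⟫ ≠ 0 := by
  have h := Measure.addHaar_submodule (volume : Measure (Euc d)) _
    (orthogonal_singleton_ne_top hz)
  rw [ae_iff]
  convert h using 2
  ext x
  simp [Submodule.mem_orthogonal_singleton_iff_inner_right]

/-- A cone that is not of lower dimension has nonempty interior, hence positive volume. -/
theorem exists_mem_of_ae {C : PolyhedralCone d} (hC : ¬ C.dim < d) {p : Euc d → Prop}
    (hp : ∀ᵐ x, p x) : ∃ x ∈ C.points, p x := by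
  have hspan : Submodule.span ℝ C.points = ⊤ := by
    apply Submodule.eq_top_of_finrank_eq
    refine le_antisymm (Submodule.finrank_le _) ?_
    simpa [dim] using hC
  have hconv : Convex ℝ C.points := PointedCone.convex C.1
  have h0 : (0 : Euc d) ∈ C.points := C.1.zero_mem
  have hint : (interior C.points).Nonempty := by
    rw [hconv.interior_nonempty_iff_affineSpan_eq_top]
    refine (AffineSubspace.affineSpan_eq_top_iff_vectorSpan_eq_top_of_nonempty ℝ _ _ ⟨0, h0⟩).2 ?_
    rw [vectorSpan_eq_span_vsub_set_right ℝ h0]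
    simpa using hspan
  by_contra! hne
  have h1 : interior C.points ⊆ {x | ¬ p x} := fun x hx => hne x (interior_subset hx)
  exact (isOpen_interior.measure_pos volume hint).ne' (measure_mono_null h1 (ae_iff.1 hp))

end PolyhedralCone

namespace ConeAngle

open PolyhedralCone

variable {d : ℕ}

/-- Cutting a cone by a hyperplane splits its angle. -/
theorem map_cut [DecidableEq (Euc d)] (α : ConeAngle d) (s : Finset (Euc d)) {z : Euc d}
    (hz : z ≠ 0) :
    α (ofFinset s) = α (ofFinset (insert z s)) + α (ofFinset (insert (-z) s)) := by
  have hI : α (ofFinset (insert z (insert (-z) s))) = 0 := by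
    refine α.map_of_dim_lt' _ (dim_lt_of_subset_hyperplane hz fun x hx => ?_)
    simp only [mem_points_ofFinset, Finset.forall_mem_insert, inner_neg_left] at hx
    linarith [hx.1, hx.2.1]
  rw [α.map_union' (ofFinset (insert z s)) (ofFinset (insert (-z) s)) (ofFinset s)
    (ofFinset (insert z (insert (-z) s))) ?_ ?_, hI, sub_zero]
  · ext x
    simp only [Set.mem_union, mem_points_ofFinset, Finset.forall_mem_insert, inner_neg_left]
    rcases le_total 0 ⟪z, x⟫ with h | h
    · simp [h]
    · simp [h]
  · ext x
    simp only [Set.mem_inter_iff, mem_points_ofFinset, Finset.forall_mem_insert]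
    tauto

/-- The local form of `sum_eq_one_of_ae_existsUnique`, inside a cone `D`: the elements of `T` are
normal vectors of the facet hyperplanes that may still cut through the interior of `D`. The
induction on `T` splits `D`, and every tile with it, along one hyperplane after the other, since the valuation
property is only available for unions that are again cones. -/
theorem sum_inter_eq_of_ae_existsUnique [DecidableEq (Euc d)] {ι : Type*} [Fintype ι]
    (α : ConeAngle d) (s : ι → Finset (Euc d))
    (hs : ∀ᵐ x, ∃! i, x ∈ (ofFinset (s i)).points) (T : Finset (Euc d)) :
    ∀ D : Finset (Euc d),
      (∀ i, ∀ z ∈ s i, z ≠ 0 → z ∈ T ∨ (∀ x ∈ (ofFinset D).points, 0 ≤ ⟪z, x⟫) ∨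
        ∀ x ∈ (ofFinset D).points, ⟪z, x⟫ ≤ 0) →
      ∑ i, α (ofFinset (s i ∪ D)) = α (ofFinset D) := by
  have mem_union (i : ι) (D : Finset (Euc d)) (x : Euc d) :
      x ∈ (ofFinset (s i ∪ D)).points ↔
        x ∈ (ofFinset (s i)).points ∧ x ∈ (ofFinset D).points := by
    simp only [mem_points_ofFinset, Finset.mem_union, or_imp, forall_and]
  induction T using Finset.induction_on with
  | empty =>
    intro D hD
    by_cases hdim : (ofFinset D).dim < d
    · rw [α.map_of_dim_lt' _ hdim]
      refine Finset.sum_eq_zero fun i _ => α.map_of_dim_lt' _ (lt_of_le_of_lt ?_ hdim)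
      exact Submodule.finrank_mono (Submodule.span_mono fun x hx => ((mem_union i D x).1 hx).2)
    · have hgen : ∀ᵐ x : Euc d, ∀ i, ∀ z ∈ s i, z ≠ 0 → ⟪z, x⟫ ≠ 0 := by
        rw [ae_all_iff]
        intro i
        rw [Finset.eventually_all]
        intro z _
        by_cases hz : z = 0
        · exact .of_forall fun _ h => absurd hz h
        · filter_upwards [ae_inner_ne_zero hz] with x hx _ using hx
      -- A generic point of `D` lies in exactly one of the tiles, and this tile contains `D`.
      obtain ⟨x, hxD, ⟨i, hi, huniq⟩, hx⟩ := exists_mem_of_ae hdim (hs.and hgen)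
      rw [Finset.sum_eq_single i]
      · congr 1
        apply eq_of_points_eq
        ext y
        refine (mem_union i D y).trans ⟨And.right, fun hy => ⟨?_, hy⟩⟩
        rw [mem_points_ofFinset]
        intro z hz
        by_cases hz0 : z = 0
        · simp [hz0]
        rcases (hD i z hz hz0).resolve_left (Finset.notMem_empty z) with h | h
        · exact h y hy
        · exact absurd (le_antisymm (h x hxD) (mem_points_ofFinset.1 hi z hz)) (hx i z hz hz0)
      · intro j _ hji
        have hj : x ∉ (ofFinset (s j)).points := fun h => hji (huniq j h)
        rw [mem_points_ofFinset] at hj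
        push Not at hj
        obtain ⟨z, hz, hzx⟩ := hj
        have hz0 : z ≠ 0 := by
          rintro rfl
          simp at hzx
        rcases (hD j z hz hz0).resolve_left (Finset.notMem_empty z) with h | h
        · exact absurd (h x hxD) (not_le.2 hzx)
        · refine α.map_of_dim_lt' _ (dim_lt_of_subset_hyperplane hz0 fun y hy => ?_)
          rw [mem_union] at hy
          exact le_antisymm (h y hy.2) (mem_points_ofFinset.1 hy.1 z hz)
      · exact fun h => absurd (Finset.mem_univ i) h
  | insert z T _ ih =>
    intro D hD
    by_cases hz : z = 0
    · refine ih D fun i w hw hw0 => ?_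
      rcases hD i w hw hw0 with h | h
      · exact Or.inl ((Finset.mem_insert.1 h).resolve_left fun h' => hw0 (h'.trans hz))
      · exact Or.inr h
    · have sub (w : Euc d) (x : Euc d) (hx : x ∈ (ofFinset (insert w D)).points) :
          0 ≤ ⟪w, x⟫ ∧ x ∈ (ofFinset D).points := by
        rwa [mem_points_ofFinset, Finset.forall_mem_insert, ← mem_points_ofFinset] at hx
      rw [α.map_cut D hz, ← ih (insert z D), ← ih (insert (-z) D), ← Finset.sum_add_distrib]
      · refine Finset.sum_congr rfl fun i _ => ?_
        rw [Finset.union_insert, Finset.union_insert, ← α.map_cut _ hz]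
      · intro i w hw hw0
        rcases hD i w hw hw0 with h | h | h
        · rcases Finset.mem_insert.1 h with rfl | h
          · refine Or.inr (Or.inr fun x hx => ?_)
            simpa using (sub _ x hx).1
          · exact Or.inl h
        · exact Or.inr (Or.inl fun x hx => h x (sub _ x hx).2)
        · exact Or.inr (Or.inr fun x hx => h x (sub _ x hx).2)
      · intro i w hw hw0
        rcases hD i w hw hw0 with h | h | h
        · rcases Finset.mem_insert.1 h with rfl | h
          · exact Or.inr (Or.inl fun x hx => (sub _ x hx).1)
          · exact Or.inl h
        · exact Or.inr (Or.inl fun x hx => h x (sub _ x hx).2)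
        · exact Or.inr (Or.inr fun x hx => h x (sub _ x hx).2)

/-- The angles of the cones of a finite tiling of `ℝ^d` add up to `1`. -/
theorem sum_eq_one_of_ae_existsUnique {ι : Type*} [Fintype ι] (α : ConeAngle d)
    (C : ι → PolyhedralCone d) (hC : ∀ᵐ x, ∃! i, x ∈ (C i).points) : ∑ i, α (C i) = 1 := by
  classical
  choose s hs using fun i => exists_eq_ofFinset (C i)
  simp only [hs] at hC ⊢
  have h := α.sum_inter_eq_of_ae_existsUnique s hC (Finset.univ.biUnion s) ∅ fun i z hz _ =>
    Or.inl (Finset.mem_biUnion.2 ⟨i, Finset.mem_univ i, hz⟩)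
  simp only [Finset.union_empty] at h
  rw [h]
  apply α.map_univ'
  ext x
  simp [mem_points_ofFinset]

end ConeAngle

/-! ### Outer cones at parallel faces -/

section Faces

variable {d : ℕ} {F G P : Set (Euc d)}

theorem normalCone_le_orthogonal (hFP : F ⊆ P) {c : Euc d} (hc : c ∈ normalCone F P) :
    c ∈ (parallelSubspace F)ᗮ := by
  have hle : parallelSubspace F ≤ (ℝ ∙ c)ᗮ := by
    rw [parallelSubspace, vectorSpan_def, Submodule.span_le]
    rintro _ ⟨a, ha, b, hb, rfl⟩
    rw [SetLike.mem_coe, Submodule.mem_orthogonal_singleton_iff_inner_right]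
    have h1 := hc a ha b (hFP hb)
    have h2 := hc b hb a (hFP ha)
    simp only [vsub_eq_sub, inner_sub_right]
    linarith
  rw [Submodule.mem_orthogonal]
  intro u hu
  rw [real_inner_comm]
  exact Submodule.mem_orthogonal_singleton_iff_inner_right.1 (hle hu)

/-- The outer cone is the preimage of the normal cone under the orthogonal projection along `L(F)`. -/
theorem mem_outerCone_iff (hFP : F ⊆ P) {x : Euc d} :
    x ∈ outerCone F P ↔ (parallelSubspace F)ᗮ.starProjection x ∈ normalCone F P := by
  constructor
  · intro h
    obtain ⟨c, hc, l, hl, rfl⟩ := Submodule.mem_sup.1 h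
    have e1 : (parallelSubspace F)ᗮ.starProjection c = c :=
      Submodule.starProjection_eq_self_iff.2 (normalCone_le_orthogonal hFP hc)
    have e2 : (parallelSubspace F)ᗮ.starProjection l = 0 :=
      (Submodule.starProjection_apply_eq_zero_iff _).2
        (by rw [Submodule.orthogonal_orthogonal]; exact hl)
    rwa [map_add, e1, e2, add_zero]
  · intro h
    have hs : x = (parallelSubspace F)ᗮ.starProjection x +
        (parallelSubspace F).starProjection x := by
      rw [add_comm, Submodule.starProjection_add_starProjection_orthogonal]
    rw [hs]
    exact Submodule.add_mem_sup h (Submodule.starProjection_apply_mem (parallelSubspace F) x)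

/-- The face of `P` on which the linear function `⟪c, ·⟫` is maximal. -/
def maxFace (P : Set (Euc d)) (c : Euc d) : Set (Euc d) :=
  {x ∈ P | ∀ y ∈ P, ⟪c, y⟫ ≤ ⟪c, x⟫}

theorem isExposed_maxFace (P : Set (Euc d)) (c : Euc d) : IsExposed ℝ P (maxFace P c) :=
  fun _ => ⟨InnerProductSpace.toDual ℝ (Euc d) c, by simp [maxFace]⟩

theorem IsExposed.exists_eq_maxFace (h : IsExposed ℝ P F) (hF : F.Nonempty) :
    ∃ c, F = maxFace P c := by
  obtain ⟨l, rfl⟩ := h hF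
  refine ⟨(InnerProductSpace.toDual ℝ (Euc d)).symm l, ?_⟩
  simp [maxFace]

theorem mem_normalCone_maxFace (P : Set (Euc d)) (c : Euc d) : c ∈ normalCone (maxFace P c) P :=
  fun _ hx y hy => hx.2 y hy

/-- A subset of `P` that lies in the affine hull of an exposed face lies in the face. -/
theorem IsExposed.subset_of_parallelSubspace_le {f g : Euc d} (hF : IsExposed ℝ P F)
    (hf : f ∈ F) (hg : g ∈ G) (hGP : G ⊆ P) (hL : parallelSubspace G ≤ parallelSubspace F)
    (hfg : f - g ∈ parallelSubspace F) : G ⊆ F := by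
  obtain ⟨c, rfl⟩ := hF.exists_eq_maxFace ⟨f, hf⟩
  intro x hx
  have h1 : f - x ∈ parallelSubspace (maxFace P c) := by
    have := add_mem hfg (hL (vsub_mem_vectorSpan ℝ hg hx))
    simpa using this
  have h2 : ⟪f - x, c⟫ = 0 :=
    (Submodule.mem_orthogonal _ _).1
      (normalCone_le_orthogonal hF.subset (mem_normalCone_maxFace P c)) _ h1
  rw [real_inner_comm, inner_sub_right, sub_eq_zero] at h2
  exact ⟨hGP hx, fun y hy => h2 ▸ hf.2 y hy⟩

/-- The outer cones at distinct parallel faces overlap in a null set: they lie on opposite sides of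
a hyperplane, whose normal vector is the difference of a point of `F` and a point of `G`, projected
to the orthogonal complement of the common parallel subspace. -/
theorem ae_notMem_outerCone_of_ne (hF : IsExposed ℝ P F) (hG : IsExposed ℝ P G)
    (hF' : F.Nonempty) (hG' : G.Nonempty) (hL : parallelSubspace F = parallelSubspace G)
    (hne : F ≠ G) : ∀ᵐ x, ¬ (x ∈ outerCone F P ∧ x ∈ outerCone G P) := by
  obtain ⟨f, hf⟩ := hF'
  obtain ⟨g, hg⟩ := hG'
  have hfg : f - g ∉ parallelSubspace F := by
    intro h
    apply hne
    apply Set.Subset.antisymm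
    · refine hG.subset_of_parallelSubspace_le hg hf hF.subset hL.le ?_
      rw [← hL, ← neg_sub]
      exact neg_mem h
    · exact hF.subset_of_parallelSubspace_le hf hg hG.subset hL.ge h
  have hw : (parallelSubspace F)ᗮ.starProjection (f - g) ≠ 0 := by
    rwa [Ne, Submodule.starProjection_apply_eq_zero_iff, Submodule.orthogonal_orthogonal]
  filter_upwards [PolyhedralCone.ae_inner_ne_zero hw] with x hx ⟨hxF, hxG⟩
  rw [mem_outerCone_iff hF.subset] at hxF
  rw [mem_outerCone_iff hG.subset, ← hL] at hxG
  apply hx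
  rw [Submodule.inner_starProjection_left_eq_right, real_inner_comm, inner_sub_right]
  have h1 := hxF f hf g (hG.subset hg)
  have h2 := hxG g hg f (hF.subset hf)
  linarith

end Faces

namespace Polytope

variable {d : ℕ}

theorem isCompact (P : Polytope d) : IsCompact P.points := by
  obtain ⟨V, hV⟩ := P.isPolytope'
  rw [hV]
  exact V.finite_toSet.isCompact_convexHull ℝ

theorem maxFace_nonempty (P : Polytope d) (hP : P.points.Nonempty) (c : Euc d) :
    (maxFace P.points c).Nonempty := by
  obtain ⟨x, hx, hmax⟩ := P.isCompact.exists_isMaxOn hP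
    (f := fun x => ⟪c, x⟫) (by fun_prop)
  exact ⟨x, hx, fun y hy => hmax hy⟩

/-- In a generic direction, the maximal face of a polytope is a vertex. -/
theorem ae_parallelSubspace_maxFace_eq_bot (P : Polytope d) :
    ∀ᵐ c, parallelSubspace (maxFace P.points c) = ⊥ := by
  obtain ⟨V, hV⟩ := P.isPolytope'
  have hgen : ∀ᵐ c : Euc d, ∀ v ∈ V, ∀ w ∈ V, v - w ≠ 0 → ⟪v - w, c⟫ ≠ 0 := by
    rw [Finset.eventually_all]
    intro v _
    rw [Finset.eventually_all]
    intro w _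
    by_cases hz : v - w = 0
    · exact .of_forall fun _ h => absurd hz h
    · filter_upwards [PolyhedralCone.ae_inner_ne_zero hz] with x hx _ using hx
  filter_upwards [hgen] with c hc
  have hexp := isExposed_maxFace P.points c
  have hcomp : IsCompact (maxFace P.points c) := hexp.isCompact P.isCompact
  have hconv : Convex ℝ (maxFace P.points c) :=
    hexp.convex (by rw [hV]; exact convex_convexHull ℝ _)
  -- Extreme points of the maximal face belong to `V`, where `⟪c, ·⟫` takes distinct values.
  have hext : ((maxFace P.points c).extremePoints ℝ).Subsingleton := by
    rw [hexp.isExtreme.extremePoints_eq]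
    rintro v ⟨hv, hv'⟩ w ⟨hw, hw'⟩
    have hVs : P.points.extremePoints ℝ ⊆ (V : Set (Euc d)) := by
      rw [hV]
      exact extremePoints_convexHull_subset
    by_contra hne
    apply hc v (hVs hv') w (hVs hw') (sub_ne_zero.2 hne)
    rw [real_inner_comm, inner_sub_right, sub_eq_zero]
    exact le_antisymm (hw.2 v hv.1) (hv.2 w hw.1)
  have hsub : (maxFace P.points c).Subsingleton := by
    rw [← closure_convexHull_extremePoints hcomp hconv]
    rcases hext.eq_empty_or_singleton with h | ⟨x, h⟩ <;> simp [h]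
  exact vectorSpan_of_subsingleton ℝ hsub

end Polytope

namespace ConeAngle

variable {d : ℕ}

/-- If, in almost every direction orthogonal to `L`, the maximal face of `P` is parallel to `L`,
then the outer cones at the faces parallel to `L` tile `ℝ^d`, so that the exterior angles at these
faces add up to `1`. -/
theorem sum_face_parallel_eq_one (α : ConeAngle d) (P : Polytope d) (hP : P.points.Nonempty)
    {k : ℕ} [Fintype (P.Face k)] {L : Submodule ℝ (Euc d)} (hk : Module.finrank ℝ L = k)
    (hL : ∀ᵐ x, parallelSubspace (maxFace P.points (Lᗮ.starProjection x)) = L)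
    (s : Finset (P.Face k)) (hs : ∀ F, F ∈ s ↔ parallelSubspace F.1 = L) :
    ∑ F ∈ s, α (P.outerConeAt F) = 1 := by
  classical
  rw [Finset.sum_subtype s hs]
  apply α.sum_eq_one_of_ae_existsUnique
  have hsep : ∀ᵐ x : Euc d, ∀ F G : {F : P.Face k // parallelSubspace F.1 = L}, F ≠ G →
      ¬ (x ∈ outerCone F.1.1 P.points ∧ x ∈ outerCone G.1.1 P.points) := by
    rw [ae_all_iff]
    intro F
    rw [ae_all_iff]
    intro G
    by_cases hFG : F = G
    · exact .of_forall fun _ h => absurd hFG h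
    · have h := ae_notMem_outerCone_of_ne F.1.2.2.1 G.1.2.2.1 F.1.2.1 G.1.2.1
        (F.2.trans G.2.symm) fun h => hFG (Subtype.ext (Subtype.ext h))
      filter_upwards [h] with x hx _ using hx
  filter_upwards [hL, hsep] with x hx hsepx
  have hexp := isExposed_maxFace P.points (Lᗮ.starProjection x)
  refine ⟨⟨⟨maxFace P.points (Lᗮ.starProjection x), P.maxFace_nonempty hP _, hexp, ?_⟩, hx⟩,
    ?_, ?_⟩
  · rw [hx, hk]
  · change x ∈ outerCone _ _
    rw [mem_outerCone_iff hexp.subset, hx]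
    exact mem_normalCone_maxFace _ _
  · intro G hG
    by_contra hne
    refine hsepx _ _ hne ⟨hG, ?_⟩
    rw [mem_outerCone_iff hexp.subset, hx]
    exact mem_normalCone_maxFace _ _

/-- The exterior angles at the vertices of a polytope add up to `1`. -/
theorem exteriorAngleVector_zero (α : ConeAngle d) (hd : 0 < d) (P : Polytope d)
    (hP : P.points.Nonempty) : α.exteriorAngleVector P ⟨0, hd⟩ = 1 := by
  have := Fintype.ofFinite (P.Face 0)
  rw [exteriorAngleVector, finsum_eq_sum_of_fintype]
  refine α.sum_face_parallel_eq_one P hP (L := ⊥) (finrank_bot ℝ _) ?_ _ fun F => ?_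
  · filter_upwards [P.ae_parallelSubspace_maxFace_eq_bot] with x hx
    have e : (⊥ : Submodule ℝ (Euc d))ᗮ.starProjection x = x :=
      Submodule.starProjection_eq_self_iff.2 (by simp)
    rwa [e]
  · simpa using Submodule.finrank_eq_zero.1 F.2.2.2

end ConeAngle

/-! ### Zonotopes in general position -/

section Zonotope

variable {d : ℕ} {ι : Type*}

/-- The zonotope `∑ i, [0, v i]`. -/
noncomputable def zonotope [Fintype ι] (v : ι → Euc d) : Polytope d where
  points := Fintype.linearCombination ℝ v '' Set.univ.pi fun _ => Set.Icc (0 : ℝ) 1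
  isPolytope' := by
    classical
    refine ⟨(Fintype.piFinset fun _ => ({0, 1} : Finset ℝ)).image (Fintype.linearCombination ℝ v),
      ?_⟩
    rw [Finset.coe_image, Fintype.coe_piFinset, ← LinearMap.image_convexHull, convexHull_pi]
    simp [convexHull_pair, segment_eq_Icc]

theorem mem_zonotope [Fintype ι] {v : ι → Euc d} {x : Euc d} :
    x ∈ (zonotope v).points ↔ ∃ t : ι → ℝ, (∀ i, 0 ≤ t i ∧ t i ≤ 1) ∧ ∑ i, t i • v i = x := by
  simp [zonotope, Fintype.linearCombination_apply, Pi.le_def, forall_and]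

theorem zonotope_nonempty [Fintype ι] (v : ι → Euc d) : (zonotope v).points.Nonempty :=
  ⟨0, mem_zonotope.2 ⟨0, by simp⟩⟩

/-- The maximal face of a zonotope in direction `c` is parallel to the span of the generators
orthogonal to `c`: it is a translate of the zonotope that they generate. -/
theorem parallelSubspace_maxFace_zonotope [Fintype ι] (v : ι → Euc d) (c : Euc d) :
    parallelSubspace (maxFace (zonotope v).points c) =
      Submodule.span ℝ (v '' {i | ⟪c, v i⟫ = 0}) := by
  classical
  -- The coefficients of one maximizer; only those with `⟪c, v i⟫ = 0` may be varied.
  set t₀ : ι → ℝ := fun i => if 0 < ⟪c, v i⟫ then 1 else 0 with ht₀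
  have inner_sum' (t : ι → ℝ) : ⟪c, ∑ i, t i • v i⟫ = ∑ i, t i * ⟪c, v i⟫ := by
    simp [inner_sum, inner_smul_right]
  have hle (t : ι → ℝ) (ht : ∀ i, 0 ≤ t i ∧ t i ≤ 1) (i : ι) :
      t i * ⟪c, v i⟫ ≤ t₀ i * ⟪c, v i⟫ := by
    simp only [ht₀]
    split_ifs with h
    · exact mul_le_mul_of_nonneg_right (ht i).2 h.le
    · rw [zero_mul]
      exact mul_nonpos_of_nonneg_of_nonpos (ht i).1 (not_lt.1 h)
  have hmax (t : ι → ℝ) (ht : ∀ i, 0 ≤ t i ∧ t i ≤ 1) (h : ∀ i, ⟪c, v i⟫ ≠ 0 → t i = t₀ i) :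
      ∑ i, t i • v i ∈ maxFace (zonotope v).points c := by
    refine ⟨mem_zonotope.2 ⟨t, ht, rfl⟩, fun y hy => ?_⟩
    obtain ⟨u, hu, rfl⟩ := mem_zonotope.1 hy
    rw [inner_sum', inner_sum']
    refine Finset.sum_le_sum fun i _ => ?_
    by_cases hi : ⟪c, v i⟫ = 0
    · simp [hi]
    · rw [h i hi]
      exact hle u hu i
  have h01 (i : ι) : 0 ≤ t₀ i ∧ t₀ i ≤ 1 := by
    simp only [ht₀]
    split_ifs <;> simp
  have hmem (x : Euc d) (hx : x ∈ maxFace (zonotope v).points c) :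
      x - ∑ i, t₀ i • v i ∈ Submodule.span ℝ (v '' {i | ⟪c, v i⟫ = 0}) := by
    obtain ⟨t, ht, rfl⟩ := mem_zonotope.1 hx.1
    have h1 := hx.2 _ (mem_zonotope.2 ⟨t₀, h01, rfl⟩)
    rw [inner_sum', inner_sum'] at h1
    have h2 := (Finset.sum_eq_sum_iff_of_le fun i _ => hle t ht i).1
      (le_antisymm (Finset.sum_le_sum fun i _ => hle t ht i) h1)
    rw [← Finset.sum_sub_distrib]
    refine Submodule.sum_mem _ fun i hi => ?_
    rw [← sub_smul]
    by_cases h0 : ⟪c, v i⟫ = 0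
    · exact Submodule.smul_mem _ _ (Submodule.subset_span ⟨i, h0, rfl⟩)
    · rw [mul_right_cancel₀ h0 (h2 i hi)]
      simp
  apply le_antisymm
  · rw [parallelSubspace, vectorSpan_def, Submodule.span_le]
    rintro _ ⟨x, hx, y, hy, rfl⟩
    have := sub_mem (hmem x hx) (hmem y hy)
    simpa using this
  · rw [Submodule.span_le]
    rintro _ ⟨i, hi, rfl⟩
    have hi : ⟪c, v i⟫ = 0 := hi
    have h1 := hmax (Function.update t₀ i 1)
      (fun j => by by_cases hj : j = i <;> simp [hj, h01])
      (fun j hj => Function.update_of_ne (by rintro rfl; exact hj hi) _ _)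
    have h2 := hmax t₀ h01 fun _ _ => rfl
    have h3 := vsub_mem_vectorSpan ℝ h1 h2
    rw [vsub_eq_sub, ← Finset.sum_sub_distrib, Finset.sum_eq_single i] at h3
    · simpa [ht₀, hi] using h3
    · intro j _ hj
      simp [Function.update_of_ne hj]
    · simp

/-- Vectors of `ℝ^d` are in linearly general position if any `d` of them, or fewer, are linearly
independent. -/
def InGeneralPosition (v : ι → Euc d) : Prop :=
  ∀ S : Finset ι, S.card ≤ d → LinearIndepOn ℝ v (S : Set ι)

/-- Points on the moment curve are in general position. A linear relation between the vectors with
indices in `S` is paired with the polynomial of degree `#S - 1 < d` that vanishes at all nodes in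
`S` but one. -/
theorem inGeneralPosition_momentCurve (d n : ℕ) :
    InGeneralPosition fun i : Fin n =>
      (WithLp.toLp 2 fun j : Fin d => (i : ℝ) ^ (j : ℕ) : Euc d) := by
  classical
  intro S hS
  rw [linearIndepOn_finset_iff]
  intro g hg i hi
  have hcoord (j : ℕ) (hj : j < d) : ∑ i ∈ S, g i * (i : ℝ) ^ j = 0 := by
    have := congrArg (fun x : Euc d => x ⟨j, hj⟩) hg
    simpa using this
  set p : Polynomial ℝ := ∏ k ∈ S.erase i, (Polynomial.X - Polynomial.C (k : ℝ)) with hp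
  have hdeg : p.natDegree < d := by
    rw [hp, Polynomial.natDegree_prod_of_monic _ _ fun k _ => Polynomial.monic_X_sub_C _]
    simp only [Polynomial.natDegree_X_sub_C, Finset.sum_const, smul_eq_mul, mul_one]
    exact lt_of_lt_of_le (Finset.card_erase_lt_of_mem hi) hS
  have hsum : ∑ k ∈ S, g k * p.eval (k : ℝ) = 0 := by
    simp only [Polynomial.eval_eq_sum_range' hdeg, Finset.mul_sum]
    rw [Finset.sum_comm]
    refine Finset.sum_eq_zero fun j hj => ?_
    have := congrArg (p.coeff j * ·) (hcoord j (Finset.mem_range.1 hj))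
    simp only [Finset.mul_sum, mul_zero] at this
    rw [← this]
    exact Finset.sum_congr rfl fun k _ => by ring
  rw [Finset.sum_eq_single_of_mem i hi] at hsum
  · refine (mul_eq_zero.1 hsum).resolve_right ?_
    rw [hp, Polynomial.eval_prod, ← Ne, Finset.prod_ne_zero_iff]
    intro k hk
    have : (i : ℕ) ≠ k := fun h => (Finset.mem_erase.1 hk).1 (Fin.ext h.symm)
    simpa [sub_eq_zero] using this
  · intro k hk hki
    rw [hp, Polynomial.eval_prod, Finset.prod_eq_zero (Finset.mem_erase.2 ⟨hki, hk⟩) (by simp),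
      mul_zero]

namespace InGeneralPosition

variable {v : ι → Euc d}

theorem finrank_span (hv : InGeneralPosition v) {S : Finset ι} (hS : S.card ≤ d) :
    Module.finrank ℝ (Submodule.span ℝ (v '' S)) = S.card := by
  have h := finrank_span_eq_card (hv S hS)
  rw [← Set.image_eq_range] at h
  simpa using h

theorem mem_span_iff (hv : InGeneralPosition v) {S : Finset ι} (hS : S.card < d) {i : ι} :
    v i ∈ Submodule.span ℝ (v '' S) ↔ i ∈ S := by
  classical
  refine ⟨fun h => ?_, fun h => Submodule.subset_span ⟨i, h, rfl⟩⟩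
  by_contra hi
  have h1 := hv (insert i S) ((Finset.card_insert_le i S).trans hS)
  rw [Finset.coe_insert, linearIndepOn_insert (mt Finset.mem_coe.1 hi)] at h1
  exact h1.2 h

theorem span_eq_top (hv : InGeneralPosition v) {S : Finset ι} (hS : d ≤ S.card) :
    Submodule.span ℝ (v '' S) = ⊤ := by
  obtain ⟨T, hTS, hT⟩ := Finset.exists_subset_card_eq hS
  have h := hv.finrank_span hT.le
  have h2 : Submodule.span ℝ (v '' T) = ⊤ :=
    Submodule.eq_top_of_finrank_eq (by rw [h, hT]; simp)
  exact top_le_iff.1 (h2 ▸ Submodule.span_mono (Set.image_mono (Finset.coe_subset.2 hTS)))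

variable [Fintype ι]

theorem dim_zonotope (hv : InGeneralPosition v) (hd : d ≤ Fintype.card ι) :
    (zonotope v).dim = d := by
  have h : maxFace (zonotope v).points 0 = (zonotope v).points := by
    simp [maxFace]
  have h2 : {i | ⟪(0 : Euc d), v i⟫ = 0} = ((Finset.univ : Finset ι) : Set ι) := by
    simp
  rw [Polytope.dim, ← h, parallelSubspace_maxFace_zonotope, h2,
    hv.span_eq_top (by simpa using hd), finrank_top, finrank_euclideanSpace_fin]

/-- The proper faces of a zonotope with generators in general position are parallel to the spans
of fewer than `d` generators, as many as the dimension of the face. -/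
theorem parallelSubspace_face_zonotope (hv : InGeneralPosition v) {k : ℕ}
    (hk : k < d) (F : (zonotope v).Face k) :
    ∃ S : Finset ι, S.card = k ∧ parallelSubspace F.1 = Submodule.span ℝ (v '' S) := by
  classical
  obtain ⟨c, hc⟩ := F.2.2.1.exists_eq_maxFace F.2.1
  have hF := parallelSubspace_maxFace_zonotope v c
  rw [← hc] at hF
  have hset : {i | ⟪c, v i⟫ = 0} =
      ((Finset.univ.filter fun i => ⟪c, v i⟫ = 0 : Finset ι) : Set ι) := by
    simp
  rw [hset] at hF
  refine ⟨_, ?_, hF⟩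
  have hfin := F.2.2.2
  rw [hF] at hfin
  rcases le_total d (Finset.univ.filter fun i => ⟪c, v i⟫ = 0).card with h | h
  · rw [hv.span_eq_top h, finrank_top, finrank_euclideanSpace_fin] at hfin
    omega
  · rwa [hv.finrank_span h] at hfin

/-- In a generic direction orthogonal to `S`, the generators orthogonal to it are those in `S`. -/
theorem ae_parallelSubspace_maxFace (hv : InGeneralPosition v) {S : Finset ι} (hS : S.card < d) :
    ∀ᵐ x, parallelSubspace (maxFace (zonotope v).points
      ((Submodule.span ℝ (v '' S))ᗮ.starProjection x)) = Submodule.span ℝ (v '' S) := by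
  set L := Submodule.span ℝ (v '' S)
  have hgen : ∀ᵐ x : Euc d, ∀ i, i ∉ S → ⟪Lᗮ.starProjection (v i), x⟫ ≠ 0 := by
    rw [ae_all_iff]
    intro i
    by_cases hi : i ∈ S
    · exact .of_forall fun _ h => absurd hi h
    · have hw : Lᗮ.starProjection (v i) ≠ 0 := by
        rwa [Ne, Submodule.starProjection_apply_eq_zero_iff, Submodule.orthogonal_orthogonal,
          hv.mem_span_iff hS]
      filter_upwards [PolyhedralCone.ae_inner_ne_zero hw] with x hx _ using hx
  filter_upwards [hgen] with x hx
  rw [parallelSubspace_maxFace_zonotope]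
  congr 2
  ext i
  constructor
  · intro h
    by_contra hi
    apply hx i hi
    rw [Submodule.inner_starProjection_left_eq_right, real_inner_comm]
    exact h
  · intro hi
    exact (real_inner_comm _ _).trans ((Submodule.mem_orthogonal _ _).1
      (Submodule.starProjection_apply_mem Lᗮ x) _ (Submodule.subset_span ⟨i, hi, rfl⟩))

/-- The exterior angle vector of a zonotope with `n` generators in general position does not depend
on the cone angle: its `k`-th entry is the number of subspaces spanned by `k` generators. -/
theorem exteriorAngleVector_zonotope (hv : InGeneralPosition v) (α : ConeAngle d) (k : Fin d) :
    α.exteriorAngleVector (zonotope v) k = (Fintype.card ι).choose k := by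
  classical
  have := Fintype.ofFinite ((zonotope v).Face k)
  rw [ConeAngle.exteriorAngleVector, finsum_eq_sum_of_fintype]
  choose T hTcard hT using fun F => hv.parallelSubspace_face_zonotope k.2 F
  rw [← Finset.sum_fiberwise_of_maps_to (t := Finset.univ.powersetCard k) (g := T)
    fun F _ => Finset.mem_powersetCard.2 ⟨Finset.subset_univ _, hTcard F⟩]
  rw [Finset.sum_congr rfl (g := fun _ => (1 : ℝ))]
  · simp
  · intro S hS
    obtain ⟨-, hS⟩ := Finset.mem_powersetCard.1 hS
    have hSd : S.card < d := hS ▸ k.2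
    refine α.sum_face_parallel_eq_one (zonotope v) (zonotope_nonempty v)
      ((hv.finrank_span hSd.le).trans hS) (hv.ae_parallelSubspace_maxFace hSd) _ fun F => ?_
    rw [Finset.mem_filter, hT F]
    refine ⟨fun h => by rw [h.2], fun h => ⟨Finset.mem_univ F, ?_⟩⟩
    -- A set of fewer than `d` generators is determined by its span.
    ext i
    rw [← hv.mem_span_iff ((hTcard F).trans_lt k.2), h, hv.mem_span_iff hSd]

end InGeneralPosition

end Zonotope

/-! ### The linear relation -/

/-- Linear independence of the functions `n ↦ n.choose i` on all large `n`. Taking differences in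
`n` lowers the degree by one. -/
theorem eq_zero_of_sum_mul_choose_eq_zero {m N : ℕ} {a : ℕ → ℝ}
    (h : ∀ n ≥ N, ∑ i ∈ Finset.range m, a i * (n.choose i : ℝ) = 0) : ∀ i < m, a i = 0 := by
  induction m generalizing a with
  | zero => simp
  | succ m ih =>
    have hstep : ∀ i < m, a (i + 1) = 0 := by
      refine ih (a := fun i => a (i + 1)) fun n hn => ?_
      have h1 := h (n + 1) (hn.trans n.le_succ)
      have h2 := h n hn
      rw [Finset.sum_range_succ'] at h1 h2
      simp only [Nat.choose_succ_succ, Nat.cast_add, mul_add, Finset.sum_add_distrib,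
        Nat.choose_zero_right] at h1 h2
      linarith
    have h0 := h N le_rfl
    rw [Finset.sum_range_succ', Finset.sum_eq_zero fun i hi => by
      rw [hstep i (Finset.mem_range.1 hi), zero_mul]] at h0
    intro i hi
    cases i with
    | zero => simpa using h0
    | succ i => exact hstep i (by omega)

/-- The zonotopes in general position already exclude every relation but `α̌₀ = 1`. -/
theorem ConeAngle.eq_single_of_forall_sum_eq {d : ℕ} (hd : 1 ≤ d) (α : ConeAngle d) {c : Fin d → ℝ}
    {b : ℝ} (h : ∀ P : Polytope d, P.dim = d → ∑ i : Fin d, c i * α.exteriorAngleVector P i = b) :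
    c = Pi.single ⟨0, hd⟩ b := by
  have hzono (n : ℕ) (hn : d ≤ n) :
      ∑ i : Fin d, (c - Pi.single ⟨0, hd⟩ b : Fin d → ℝ) i * (n.choose i : ℝ) = 0 := by
    have hv := inGeneralPosition_momentCurve d n
    have h1 := h _ (hv.dim_zonotope (by simpa using hn))
    simp only [hv.exteriorAngleVector_zonotope, Fintype.card_fin] at h1
    simp [sub_mul, h1, Pi.single_apply, Finset.sum_sub_distrib, ite_mul]
  have h0 := eq_zero_of_sum_mul_choose_eq_zero (m := d) (N := d)
    (a := fun i => if hi : i < d then (c - Pi.single ⟨0, hd⟩ b : Fin d → ℝ) ⟨i, hi⟩ else 0)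
    fun n hn => by
      rw [← hzono n hn, Finset.sum_range]
      simp
  rw [← sub_eq_zero]
  ext i
  simpa using h0 i i.2

theorem mainTheorem8 (d : ℕ) (hd : 1 ≤ d) (α : ConeAngle d) :
    (affineSpan ℝ {a : Fin d → ℝ | ∃ P : Polytope d, P.dim = d ∧ α.exteriorAngleVector P = a} :
        Set (Fin d → ℝ)) = {a : Fin d → ℝ | a ⟨0, hd⟩ = 1} ∧
    ∀ (c : Fin d → ℝ) (b : ℝ),
      (∀ P : Polytope d, P.dim = d → ∑ i : Fin d, c i * α.exteriorAngleVector P i = b) ↔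
        c = Pi.single ⟨0, hd⟩ b := by
  have hzero (P : Polytope d) (hP : P.dim = d) : α.exteriorAngleVector P ⟨0, hd⟩ = 1 := by
    refine α.exteriorAngleVector_zero hd P (Set.nonempty_iff_ne_empty.2 fun h => ?_)
    rw [Polytope.dim, h, parallelSubspace, vectorSpan_empty, finrank_bot] at hP
    omega
  set A := {a : Fin d → ℝ | ∃ P : Polytope d, P.dim = d ∧ α.exteriorAngleVector P = a}
  refine ⟨Set.Subset.antisymm ?_ ?_, fun c b => ⟨α.eq_single_of_forall_sum_eq hd, ?_⟩⟩
  · have hle : affineSpan ℝ A ≤ (AffineSubspace.mk' 1 (LinearMap.proj ⟨0, hd⟩ :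
        (Fin d → ℝ) →ₗ[ℝ] ℝ).ker) := by
      rw [affineSpan_le]
      rintro _ ⟨P, hP, rfl⟩
      simp [AffineSubspace.mem_mk', hzero P hP]
    intro a ha
    have := hle ha
    simpa [AffineSubspace.mem_mk', sub_eq_zero] using this
  · intro a ha
    have hv := inGeneralPosition_momentCurve d d
    obtain ⟨p, hp⟩ : A.Nonempty := ⟨_, _, hv.dim_zonotope (by simp), rfl⟩
    by_contra hmem
    have hdir : a - p ∉ vectorSpan ℝ A := by
      intro h
      apply hmem
      have := AffineSubspace.vadd_mem_of_mem_direction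
        (by rwa [direction_affineSpan] : a - p ∈ (affineSpan ℝ A).direction)
        (mem_affineSpan ℝ hp)
      simpa using this
    -- A linear function that is constant on `A` but not on `A ∪ {a}` would be a second relation.
    obtain ⟨φ, hφ, hker⟩ := Submodule.exists_le_ker_of_notMem hdir
    have hφsum (x : Fin d → ℝ) : ∑ i, φ (Pi.single i 1) * x i = φ x := by
      conv_rhs => rw [LinearMap.pi_apply_eq_sum_univ φ x]
      refine Finset.sum_congr rfl fun i _ => ?_
      rw [smul_eq_mul, mul_comm]
      congr 2
      ext j
      simp [Pi.single_apply, eq_comm]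
    have hc := α.eq_single_of_forall_sum_eq hd (c := fun i => φ (Pi.single i 1)) (b := φ p)
      fun P hP => by
        rw [hφsum, ← sub_eq_zero, ← map_sub]
        exact hker (vsub_mem_vectorSpan ℝ ⟨P, hP, rfl⟩ hp)
    apply hφ
    obtain ⟨P, hP, rfl⟩ := hp
    have ha : a ⟨0, hd⟩ = 1 := ha
    rw [← hφsum]
    simp only [congrFun hc, Pi.single_apply, ite_mul, zero_mul, Finset.sum_ite_eq',
      Finset.mem_univ, if_true, Pi.sub_apply, hzero P hP, ha, sub_self, mul_zero]
  · rintro rfl P hP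
    simp [Pi.single_apply, ite_mul, hzero P hP]
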